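/- **Theorem 7.5.** Let $\mathbb{F}_q$ be a finite field and let $1 \le k \le m$ be integers. A *Delsarte code* is an $\mathbb{F}_q$-linear subspace $\mathcal{C} \subseteq \mathrm{Mat}(k\times m,\mathbb{F}_q)$; all dimensions are over $\mathbb{F}_q$. Its maximum rank is $\mathrm{maxrk}(\mathcal{C}) = \max\{\mathrm{rk}(M) : M \in \mathcal{C}\}$, and its dual is $\mathcal{C}^\perp = \{N \in \mathrm{Mat}(k\times m,\mathbb{F}_q) : \mathrm{Tr}(MN^{t}) = 0 \text{ for all } M \in \mathcal{C}\}$. A Delsarte code $\mathcal{A}$ is an *optimal anticode* if $\dim \mathcal{A} = m\cdot \mathrm{maxrk}(\mathcal{A})$. For $1 \le r \le \dim\mathcal{C}$, the $r$-th *Delsarte generalized weight* of $\mathcal{C}$ is $$a_r(\mathcal{C}) = \frac1m \min\{\dim \mathcal{A} : \mathcal{A} \subseteq \mathrm{Mat}(k\times m,\mathbb{F}_q) \text{ an optimal anticode},\ \dim(\mathcal{A}\cap\mathcal{C}) \ge r\}.$$ Let $\mathcal{C} \subseteq \mathrm{Mat}(k\times m,\mathbb{F}_q)$ be a Delsarte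 code of dimension $t$ with $1 \le t \le km-1$, and let $p,i,j \in \mathbb{Z}$ satisfy $1 \le p+im \le km-t$ and $1 \le p+t+jm \le t$. Then $$a_{p+im}(\mathcal{C}^\perp) \ne k+1-a_{p+t+jm}(\mathcal{C}).$$ -/

import Mathlib

namespace Delsarte

/-- A Delsarte (rank-metric) code of size `k × m` over `F`: an `F`-linear subspace of the space of
`k × m` matrices. -/
abbrev Code (F : Type*) [Field F] (k m : ℕ) : Type _ :=
  Submodule F (Matrix (Fin k) (Fin m) F)

/-- The maximum rank of a code. The set of ranks contains `0` and is bounded above by `k`, so the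
supremum is a maximum. -/
noncomputable def maxrk {F : Type*} [Field F] {k m : ℕ} (C : Code F k m) : ℕ :=
  sSup {r : ℕ | ∃ M ∈ C, M.rank = r}

/-- A Delsarte optimal anticode: a code with `dim A = m * maxrk A`. -/
def IsOptimalAnticode {F : Type*} [Field F] {k m : ℕ} (A : Code F k m) : Prop :=
  Module.finrank F A = m * maxrk A

/-- The `r`-th Delsarte generalized weight
`(1 / m) * min {dim A : A optimal anticode, dim (A ⊓ C) ≥ r}`, meaningful for
`1 ≤ r ≤ dim C` and `1 ≤ k ≤ m`. The whole matrix space is then a competitor, so the infimum is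
a minimum. -/
noncomputable def genWeight {F : Type*} [Field F] {k m : ℕ} (C : Code F k m) (r : ℤ) : ℚ :=
  (1 / (m : ℚ)) *
    ((sInf {d : ℕ | ∃ A : Code F k m, IsOptimalAnticode A ∧
      r ≤ (Module.finrank F (A ⊓ C : Code F k m) : ℤ) ∧ Module.finrank F A = d} : ℕ) : ℚ)

/-- The trace-product `⟨M, N⟩ = Tr (M Nᵗ)` of two matrices of the same size. -/
def traceProduct {F : Type*} [Field F] {k m : ℕ} (M N : Matrix (Fin k) (Fin m) F) : F :=
  Matrix.trace (M * N.transpose)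

/-- The dual of a code with respect to the trace-product. -/
def dual {F : Type*} [Field F] {k m : ℕ} (C : Code F k m) : Code F k m where
  carrier := {N | ∀ M ∈ C, traceProduct M N = 0}
  add_mem' := by
    intro a b ha hb M hM
    have h1 := ha M hM
    have h2 := hb M hM
    simp only [traceProduct] at h1 h2 ⊢
    rw [Matrix.transpose_add, Matrix.mul_add, Matrix.trace_add, h1, h2, add_zero]
  zero_mem' := by
    intro M _
    simp [traceProduct]
  smul_mem' := by
    intro c a ha M hM
    have h1 := ha M hM
    simp only [traceProduct] at h1 ⊢
    rw [Matrix.transpose_smul, Matrix.mul_smul, Matrix.trace_smul, h1, smul_zero]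

end Delsarte

/-! Suppose equality holds, and let `A` and `B` be optimal anticodes attaining the weights of `C`
and `dual C`, so a + b = k + 1 for their maximum ranks. The duals of `A` and `B` are optimal
anticodes of maximum ranks b - 1 and a - 1, too small to compete for the other weight. Counting
dimensions in `dual A ⊓ dual C` and `dual B ⊓ C` then gives k - a + j < i < k - a + j + 1, absurd
for integers. The core is `IsOptimalAnticode.dual`, proved with Gabidulin codes: with μ = `maxrk A`,
a syndrome map with μ coordinates is injective on `A`, hence bijective when `A` is optimal. A
functional given by a matrix of rank above k - μ factors through such a map, so it cannot vanish on
`A`. -/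

namespace Delsarte

open Module

/-! ### Linearized polynomials and Moore matrices -/

section LinearizedPolynomials

variable (F : Type*) {L : Type*} [Field F] [Fintype F] [Field L] [Algebra F L]

/-- The `F`-linear map `x ↦ ∑ j, c j * x ^ q ^ j` given by a linearized polynomial of `q`-degree
less than `n`, where `q` is the cardinality of `F`. -/
noncomputable def linearized {n : ℕ} (c : Fin n → L) : L →ₗ[F] L :=
  ∑ j, c j • (FiniteField.frobeniusAlgHom F L ^ (j : ℕ)).toLinearMap

theorem frobeniusAlgHom_pow_apply (j : ℕ) (x : L) :
    (FiniteField.frobeniusAlgHom F L ^ j) x = x ^ Fintype.card F ^ j := by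
  rw [AlgHom.coe_pow, FiniteField.coe_frobeniusAlgHom, pow_iterate]

theorem linearized_apply {n : ℕ} (c : Fin n → L) (x : L) :
    linearized F c x = ∑ j, c j * (FiniteField.frobeniusAlgHom F L ^ (j : ℕ)) x := by
  simp [linearized]

/-- A nonzero linearized polynomial of `q`-degree less than `n` has a space of roots of dimension
less than `n`. -/
theorem finrank_ker_linearized_lt [Finite L] {n : ℕ} {c : Fin n → L} (hc : c ≠ 0) :
    finrank F (LinearMap.ker (linearized F c)) < n := by
  classical
  obtain ⟨j₀, hj₀⟩ := Function.ne_iff.mp hc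
  have hn : 0 < n := j₀.pos
  have hq : 1 < Fintype.card F := Fintype.one_lt_card
  let P : Polynomial L :=
    ∑ j : Fin n, Polynomial.C (c j) * Polynomial.X ^ (Fintype.card F ^ (j : ℕ))
  have hcoeff : P.coeff (Fintype.card F ^ (j₀ : ℕ)) = c j₀ := by
    simp only [P, Polynomial.finsetSum_coeff, Polynomial.coeff_C_mul, Polynomial.coeff_X_pow]
    rw [Finset.sum_eq_single j₀]
    · simp
    · intro j _ hj
      rw [if_neg, mul_zero]
      intro h
      exact hj (Fin.ext (Nat.pow_right_injective hq h).symm)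
    · simp
  have hP : P ≠ 0 := by
    intro h
    rw [h, Polynomial.coeff_zero] at hcoeff
    exact hj₀ hcoeff.symm
  have hdeg : P.natDegree ≤ Fintype.card F ^ (n - 1) := by
    refine Polynomial.natDegree_sum_le_of_forall_le _ _ fun j _ => ?_
    refine (Polynomial.natDegree_C_mul_X_pow_le _ _).trans ?_
    exact Nat.pow_le_pow_right hq.le (by omega)
  have : Fintype L := Fintype.ofFinite L
  -- Kernel elements are roots of `P`, so q ^ dim ker ≤ deg P ≤ q ^ (n - 1).
  have hcard := Polynomial.card_le_degree_of_subset_roots (p := P)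
    (Z := Finset.univ.filter (· ∈ LinearMap.ker (linearized F c))) (by
      intro x hx
      simp only [Finset.filter_val, Multiset.mem_filter, LinearMap.mem_ker] at hx
      rw [Polynomial.mem_roots hP, Polynomial.IsRoot.def, ← hx.2, linearized_apply]
      simp [P, Polynomial.eval_finsetSum, frobeniusAlgHom_pow_apply])
  rw [← Fintype.card_subtype] at hcard
  have hk := Module.card_eq_pow_finrank (K := F) (V := LinearMap.ker (linearized F c))
  have h1 : Fintype.card F ^ finrank F (LinearMap.ker (linearized F c)) ≤
      Fintype.card F ^ (n - 1) := by
    rw [← hk]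
    exact (le_of_eq (Fintype.card_congr (Equiv.refl _))).trans (hcard.trans hdeg)
  have := (Nat.pow_le_pow_iff_right hq).mp h1
  omega

/-- The columns of the Moore matrix of linearly independent elements are linearly independent. -/
theorem eq_zero_of_sum_mul_frobenius_eq_zero [Finite L] {s : ℕ} {y : Fin s → L}
    (hy : LinearIndependent F y) {γ : Fin s → L}
    (h : ∀ j < s, ∑ t, γ t * (FiniteField.frobeniusAlgHom F L ^ j) (y t) = 0) : γ = 0 := by
  classical
  by_contra hγ
  let V : Matrix (Fin s) (Fin s) L :=
    Matrix.of fun j t => (FiniteField.frobeniusAlgHom F L ^ (j : ℕ)) (y t)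
  have hdet : V.det = 0 := by
    rw [← Matrix.exists_mulVec_eq_zero_iff]
    refine ⟨γ, hγ, funext fun j => ?_⟩
    rw [Pi.zero_apply, ← h j j.2]
    simp [V, Matrix.mulVec, dotProduct, mul_comm]
  -- A row dependency is a linearized polynomial of q-degree below s vanishing on the s-dimensional
  -- span of `y`.
  obtain ⟨c, hc, hcV⟩ := Matrix.exists_vecMul_eq_zero_iff.mpr hdet
  have hmem : Submodule.span F (Set.range y) ≤ LinearMap.ker (linearized F c) := by
    rw [Submodule.span_le]
    rintro _ ⟨t, rfl⟩
    have := congrFun hcV t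
    rw [SetLike.mem_coe, LinearMap.mem_ker, linearized_apply]
    simpa [V, Matrix.vecMul, dotProduct] using this
  have h1 := Submodule.finrank_mono hmem
  rw [finrank_span_eq_card hy, Fintype.card_fin] at h1
  exact absurd h1 (not_le.mpr (finrank_ker_linearized_lt F hc))

end LinearizedPolynomials

/-! ### Gabidulin syndromes: injectivity on low rank -/

section Syndrome

variable {F : Type*} {L : Type*} [Field F] [Fintype F] [Field L] [Algebra F L] {k m : ℕ}

/-- The syndrome map of a Gabidulin code: with rows identified with elements of `L` through the
family `b` and with parity-check vector `h`, it sends `M` to `(∑ i, (h i) ^ q ^ j * M i)_j`. -/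
noncomputable def syndrome (h : Fin k → L) (b : Fin m → L) (μ : ℕ) :
    Matrix (Fin k) (Fin m) F →ₗ[F] (Fin μ → L) where
  toFun M := fun j => ∑ i, (FiniteField.frobeniusAlgHom F L ^ (j : ℕ)) (h i) * ∑ l, M i l • b l
  map_add' M N := by
    ext j
    simp [add_smul, Finset.sum_add_distrib, mul_add]
  map_smul' a M := by
    ext j
    simp [mul_smul, Finset.smul_sum, Finset.mul_sum]

theorem syndrome_apply (h : Fin k → L) (b : Fin m → L) (μ : ℕ) (M : Matrix (Fin k) (Fin m) F)
    (j : Fin μ) : syndrome h b μ M j =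
      ∑ i, (FiniteField.frobeniusAlgHom F L ^ (j : ℕ)) (h i) * ∑ l, M i l • b l := rfl

/-- Frobenius fixes the entries of `M`, so the syndromes are also Moore sums in the columns `y l`,
whose span has dimension at most rank M ≤ μ. Expanding in a basis of that span, the Moore lemma and
the independence of `b` kill all coordinates. -/
theorem eq_zero_of_syndrome_eq_zero [Finite L] {h : Fin k → L} (hh : LinearIndependent F h)
    {b : Fin m → L} (hb : LinearIndependent F b) {μ : ℕ} {M : Matrix (Fin k) (Fin m) F}
    (hM : M.rank ≤ μ) (h0 : syndrome h b μ M = 0) : M = 0 := by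
  classical
  let y : Fin m → L := fun l => ∑ i, M i l • h i
  have hsyn : ∀ j < μ, ∑ l, b l * (FiniteField.frobeniusAlgHom F L ^ j) (y l) = 0 := by
    intro j hj
    have := congrFun h0 ⟨j, hj⟩
    rw [syndrome_apply] at this
    rw [← Pi.zero_apply (M := fun _ => L) (⟨j, hj⟩ : Fin μ), ← this]
    simp only [y, map_sum, map_smul, Finset.mul_sum]
    rw [Finset.sum_comm]
    refine Finset.sum_congr rfl fun i _ => Finset.sum_congr rfl fun l _ => ?_
    rw [mul_smul_comm, mul_smul_comm, mul_comm]
  let W : Submodule F L := Submodule.span F (Set.range y)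
  have hW : finrank F W ≤ μ := by
    refine le_trans ?_ hM
    rw [Matrix.rank_eq_finrank_span_cols]
    have : W = (Submodule.span F (Set.range M.col)).map (Fintype.linearCombination F h) := by
      rw [Submodule.map_span, ← Set.range_comp]
      congr 2
    rw [this]
    exact Submodule.finrank_map_le _ _
  let B := Module.finBasis F W
  have hyW : ∀ l, y l ∈ W := fun l => Submodule.subset_span ⟨l, rfl⟩
  let Q : Fin m → Fin (finrank F W) → F := fun l t => B.repr ⟨y l, hyW l⟩ t
  have hQ : ∀ l, y l = ∑ t, Q l t • (B t : L) := by
    intro l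
    have := congrArg (W.subtype) (B.sum_repr ⟨y l, hyW l⟩)
    rw [map_sum] at this
    exact this.symm
  have hB : LinearIndependent F fun t => (B t : L) :=
    B.linearIndependent.map' W.subtype (Submodule.ker_subtype W)
  have hγ := eq_zero_of_sum_mul_frobenius_eq_zero F hB (γ := fun t => ∑ l, Q l t • b l) (by
    intro j hj
    rw [← hsyn j (hj.trans_le hW)]
    simp only [hQ, map_sum, map_smul, Finset.sum_mul, Finset.mul_sum]
    rw [Finset.sum_comm]
    refine Finset.sum_congr rfl fun i _ => Finset.sum_congr rfl fun l _ => ?_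
    rw [mul_smul_comm, smul_mul_assoc])
  have hQ0 : ∀ l t, Q l t = 0 := fun l t =>
    Fintype.linearIndependent_iff.mp hb (fun l => Q l t) (congrFun hγ t) l
  ext i l
  refine Fintype.linearIndependent_iff.mp hh (fun i => M i l) ?_ i
  change y l = 0
  rw [hQ]
  simp [hQ0]

end Syndrome

/-- Two linear maps to a finite-dimensional space with the same kernel differ by an automorphism of
that space. -/
theorem exists_linearEquiv_apply_eq {K U V : Type*} [Field K] [AddCommGroup U] [Module K U]
    [AddCommGroup V] [Module K V] [FiniteDimensional K V] (f g : U →ₗ[K] V)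
    (h : LinearMap.ker f = LinearMap.ker g) : ∃ e : V ≃ₗ[K] V, ∀ u, e (f u) = g u := by
  obtain ⟨e, he⟩ := Submodule.exists_linearEquiv_restrict_eq
    (f.quotKerEquivRange.symm ≪≫ₗ Submodule.quotEquivOfEq _ _ h ≪≫ₗ g.quotKerEquivRange)
  refine ⟨e, fun u => ?_⟩
  have h1 : f.quotKerEquivRange.symm ⟨f u, LinearMap.mem_range_self f u⟩ =
      Submodule.Quotient.mk u := by
    rw [LinearEquiv.symm_apply_eq]
    rfl
  rw [← he ⟨f u, LinearMap.mem_range_self f u⟩, LinearEquiv.trans_apply, LinearEquiv.trans_apply,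
    h1]
  rfl

theorem traceProduct_eq_sum {F : Type*} [Field F] {k m : ℕ} (M N : Matrix (Fin k) (Fin m) F) :
    traceProduct M N = ∑ i, ∑ l, M i l * N i l := by
  simp [traceProduct, Matrix.trace, Matrix.mul_apply]

/-! ### Functionals factoring through a syndrome map -/

section Syndrome

variable {F : Type*} {L : Type*} [Field F] [Fintype F] [Field L] [Algebra F L] {k m : ℕ}

/-- A nonzero linearized polynomial of minimal `q`-degree vanishing on a given subspace has no
other roots. -/
theorem exists_ker_linearized_eq [Finite L] (W : Submodule F L) :
    ∃ c : Fin (finrank F W + 1) → L, LinearMap.ker (linearized F c) = W := by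
  let B := Module.finBasis F W
  let V : Matrix (Fin (finrank F W)) (Fin (finrank F W + 1)) L :=
    Matrix.of fun t j => (FiniteField.frobeniusAlgHom F L ^ (j : ℕ)) (B t : L)
  -- One more unknown coefficient than vanishing conditions.
  have hker : LinearMap.ker V.mulVecLin ≠ ⊥ :=
    LinearMap.ker_ne_bot_of_finrank_lt (by simp)
  obtain ⟨c, hc, hc0⟩ := Submodule.exists_mem_ne_zero_of_ne_bot hker
  refine ⟨c, (Submodule.eq_of_le_of_finrank_le ?_ ?_).symm⟩
  · have hW : W = Submodule.span F (Set.range fun t => (B t : L)) := by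
      have := congrArg (Submodule.map W.subtype) B.span_eq
      rw [Submodule.map_span, ← Set.range_comp, Submodule.map_subtype_top] at this
      exact this.symm
    refine hW.le.trans (Submodule.span_le.mpr ?_)
    rintro _ ⟨t, rfl⟩
    have := congrFun (LinearMap.mem_ker.mp hc) t
    rw [SetLike.mem_coe, LinearMap.mem_ker, linearized_apply]
    simpa [V, Matrix.mulVec, dotProduct, mul_comm] using this
  · exact Nat.lt_succ_iff.mp (finrank_ker_linearized_lt F hc0)

/-- If `N` has rank more than `k - μ`, the functional `M ↦ Tr (M Nᵗ)` factors through the syndrome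
map of a suitable Gabidulin code. -/
theorem exists_traceProduct_eq_syndrome [Finite L] (hL : finrank F L = m) {h : Fin k → L}
    (hh : LinearIndependent F h) {μ : ℕ} {N : Matrix (Fin k) (Fin m) F} (hN : k < μ + N.rank) :
    ∃ (b : Basis (Fin m) F L) (Λ : (Fin μ → L) →ₗ[F] F),
      ∀ M, traceProduct M N = Λ (syndrome h b μ M) := by
  classical
  let η : (Fin k → F) →ₗ[F] L := Fintype.linearCombination F h
  have hη : Function.Injective η := hh.fintypeLinearCombination_injective
  let ν : (Fin k → F) →ₗ[F] (Fin m → F) := N.vecMulLinear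
  let W : Submodule F L := (LinearMap.ker ν).map η
  have hWrank : finrank F W + N.rank = k := by
    have h1 : finrank F W = finrank F (LinearMap.ker ν) :=
      (Submodule.equivMapOfInjective η hη _).finrank_eq.symm
    have h2 := LinearMap.finrank_range_add_finrank_ker ν
    have h3 : finrank F (LinearMap.range ν) = N.rank := by
      rw [← Matrix.rank_transpose, Matrix.rank, Matrix.mulVecLin_transpose]
    rw [h1, ← h3, add_comm, h2, finrank_fin_fun]
  have hWμ : finrank F W + 1 ≤ μ := by omega
  obtain ⟨c, hc⟩ := exists_ker_linearized_eq W
  let e₀ : L ≃ₗ[F] (Fin m → F) := LinearEquiv.ofFinrankEq _ _ (by rw [hL, finrank_fin_fun])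
  -- Both maps have kernel `ker ν`; the automorphism relating them is absorbed into the basis `cb`,
  -- and the trace-dual basis `b` then expresses the entries of `N` as traces.
  obtain ⟨e₁, he₁⟩ := exists_linearEquiv_apply_eq (e₀.toLinearMap ∘ₗ linearized F c ∘ₗ η) ν (by
    rw [LinearEquiv.ker_comp, LinearMap.ker_comp, hc, Submodule.comap_map_eq_of_injective hη])
  let cb : Basis (Fin m) F L := Basis.ofEquivFun (e₀ ≪≫ₗ e₁)
  have hnd := traceForm_nondegenerate F L
  let b : Basis (Fin m) F L := (Algebra.traceForm F L).dualBasis hnd cb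
  have hb : ∀ l x, Algebra.trace F L (b l * x) = cb.repr x l := by
    intro l x
    rw [← Algebra.traceForm_apply]
    conv_lhs => rw [← cb.sum_repr x]
    simp only [b, map_sum, map_smul, LinearMap.BilinForm.apply_dualBasis_left, smul_eq_mul, mul_ite,
      mul_one, mul_zero, Finset.sum_ite_eq', Finset.mem_univ, if_true]
  have hNrow : ∀ i l, N i l = Algebra.trace F L (b l * linearized F c (h i)) := by
    intro i l
    have h1 := congrFun (he₁ (Pi.single i 1)) l
    have h2 : η (Pi.single i 1) = h i := by simp [η]
    have h3 : ν (Pi.single i 1) l = N i l := by simp [ν]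
    rw [hb, ← h3, ← h1, ← h2]
    rfl
  refine ⟨b, Algebra.trace F L ∘ₗ ∑ j : Fin (finrank F W + 1),
    c j • LinearMap.proj (R := F) (φ := fun _ : Fin μ => L) ⟨j, j.2.trans_le hWμ⟩, fun M => ?_⟩
  rw [traceProduct_eq_sum, LinearMap.comp_apply]
  have hsum : (∑ j : Fin (finrank F W + 1),
      c j • LinearMap.proj (R := F) (φ := fun _ : Fin μ => L) ⟨j, j.2.trans_le hWμ⟩)
        (syndrome h b μ M) = ∑ i, ∑ l, M i l • (b l * linearized F c (h i)) := by
    simp only [LinearMap.sum_apply, LinearMap.smul_apply, LinearMap.proj_apply, syndrome_apply,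
      linearized_apply, smul_eq_mul, Finset.mul_sum, Finset.smul_sum]
    rw [Finset.sum_comm]
    refine Finset.sum_congr rfl fun i _ => ?_
    rw [Finset.sum_comm]
    refine Finset.sum_congr rfl fun l _ => Finset.sum_congr rfl fun j _ => ?_
    rw [mul_smul_comm, mul_smul_comm]
    congr 1
    ring
  rw [hsum, map_sum]
  refine Finset.sum_congr rfl fun i _ => ?_
  rw [map_sum]
  refine Finset.sum_congr rfl fun l _ => ?_
  rw [map_smul, hNrow, smul_eq_mul]

end Syndrome

theorem exists_extension_finrank_eq (F : Type*) [Field F] [Finite F] {m : ℕ} (hm : 1 ≤ m) :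
    ∃ (L : Type) (_ : Field L) (_ : Finite L) (_ : Algebra F L), finrank F L = m := by
  obtain ⟨p, hp⟩ := CharP.exists F
  have : Fact p.Prime := ⟨CharP.char_is_prime F p⟩
  have : NeZero m := ⟨by omega⟩
  exact ⟨FiniteField.Extension F p m, inferInstance, inferInstance, inferInstance,
    FiniteField.finrank_extension F p m⟩

theorem exists_linearIndependent_fin {F V : Type*} [Field F] [AddCommGroup V] [Module F V]
    [FiniteDimensional F V] {k : ℕ} (hk : k ≤ finrank F V) :
    ∃ h : Fin k → V, LinearIndependent F h :=
  ⟨Module.finBasis F V ∘ Fin.castLE hk,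
    (Module.finBasis F V).linearIndependent.comp _ (Fin.castLE_injective hk)⟩

/-! ### Trace duality -/

section Dual

variable {F : Type*} [Field F] {k m : ℕ}

/-- The trace-product as a bilinear form. -/
def traceBilin (F : Type*) [Field F] (k m : ℕ) :
    LinearMap.BilinForm F (Matrix (Fin k) (Fin m) F) :=
  LinearMap.mk₂ F traceProduct
    (fun M M' N => by simp [traceProduct, Matrix.add_mul])
    (fun a M N => by simp [traceProduct])
    (fun M N N' => by simp [traceProduct, Matrix.mul_add])
    (fun a M N => by simp [traceProduct])

theorem traceProduct_comm (M N : Matrix (Fin k) (Fin m) F) :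
    traceProduct M N = traceProduct N M := by
  simp [traceProduct_eq_sum, mul_comm]

theorem isRefl_traceBilin : (traceBilin F k m).IsRefl := fun M N h =>
  (traceProduct_comm N M).trans h

theorem eq_zero_of_traceProduct_eq_zero {N : Matrix (Fin k) (Fin m) F}
    (h : ∀ M, traceProduct M N = 0) : N = 0 := by
  classical
  ext i l
  simpa [traceProduct_eq_sum, Matrix.single_apply, ite_and] using h (Matrix.single i l 1)

theorem nondegenerate_traceBilin : (traceBilin F k m).Nondegenerate := by
  have hrefl : LinearMap.IsRefl (traceBilin F k m) := fun M N h => isRefl_traceBilin M N h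
  refine hrefl.nondegenerate_iff_separatingRight.mpr fun N h => ?_
  exact eq_zero_of_traceProduct_eq_zero h

theorem dual_eq_orthogonal (C : Code F k m) : dual C = (traceBilin F k m).orthogonal C := rfl

theorem dual_dual (C : Code F k m) : dual (dual C) = C := by
  rw [dual_eq_orthogonal, dual_eq_orthogonal]
  exact LinearMap.BilinForm.orthogonal_orthogonal nondegenerate_traceBilin isRefl_traceBilin C

theorem finrank_add_finrank_dual (C : Code F k m) :
    finrank F C + finrank F (dual C) = k * m := by
  have h1 := LinearMap.BilinForm.finrank_orthogonal (nondegenerate_traceBilin (F := F)) C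
  have h2 := Submodule.finrank_le C
  rw [← dual_eq_orthogonal] at h1
  rw [Module.finrank_matrix, finrank_self, Fintype.card_fin, Fintype.card_fin, mul_one] at h1 h2
  omega

theorem dual_sup (A C : Code F k m) : dual (A ⊔ C) = dual A ⊓ dual C := by
  apply le_antisymm
  · exact le_inf (fun N hN M hM => hN M (Submodule.mem_sup_left hM))
      (fun N hN M hM => hN M (Submodule.mem_sup_right hM))
  · rintro N ⟨hA, hC⟩ M hM
    obtain ⟨a, ha, c, hc, rfl⟩ := Submodule.mem_sup.mp hM
    change traceBilin F k m (a + c) N = 0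
    rw [map_add, LinearMap.add_apply]
    exact (congrArg₂ (· + ·) (hA a ha) (hC c hc)).trans (add_zero 0)

theorem finrank_dual_inf_dual (A C : Code F k m) :
    finrank F (dual A ⊓ dual C : Code F k m) + finrank F A + finrank F C =
      k * m + finrank F (A ⊓ C : Code F k m) := by
  have h1 := finrank_add_finrank_dual (A ⊔ C)
  have h2 := Submodule.finrank_sup_add_finrank_inf_eq A C
  rw [dual_sup] at h1
  omega

end Dual

/-! ### Anticode bound and duality of optimal anticodes -/

section Anticode

variable {F : Type*} [Field F] {k m : ℕ}

theorem rank_le_maxrk {C : Code F k m} {M : Matrix (Fin k) (Fin m) F} (hM : M ∈ C) :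
    M.rank ≤ maxrk C := by
  refine le_csSup ⟨k, ?_⟩ ⟨M, hM, rfl⟩
  rintro _ ⟨M, _, rfl⟩
  exact M.rank_le_height

theorem maxrk_le {C : Code F k m} {r : ℕ} (h : ∀ M ∈ C, M.rank ≤ r) : maxrk C ≤ r := by
  refine csSup_le ⟨_, 0, C.zero_mem, rfl⟩ ?_
  rintro _ ⟨M, hM, rfl⟩
  exact h M hM

theorem maxrk_le_height (C : Code F k m) : maxrk C ≤ k :=
  maxrk_le fun M _ => M.rank_le_height

variable [Finite F]

/-- The anticode bound. -/
theorem finrank_le_mul_maxrk (hm : 1 ≤ m) (hkm : k ≤ m) (A : Code F k m) :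
    finrank F A ≤ m * maxrk A := by
  have : Fintype F := Fintype.ofFinite F
  obtain ⟨L, _, _, _, hL⟩ := exists_extension_finrank_eq F hm
  obtain ⟨h, hh⟩ := exists_linearIndependent_fin (F := F) (V := L) (hkm.trans hL.ge)
  obtain ⟨b, hb⟩ := exists_linearIndependent_fin (F := F) (V := L) hL.ge
  have hinj : Function.Injective ((syndrome (m := m) h b (maxrk A)).domRestrict A) := by
    rw [injective_iff_map_eq_zero]
    exact fun M hM => Subtype.ext (eq_zero_of_syndrome_eq_zero hh hb (rank_le_maxrk M.2) hM)
  have := LinearMap.finrank_le_finrank_of_injective hinj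
  rwa [finrank_pi_fintype, Finset.sum_const, Finset.card_univ, Fintype.card_fin, hL, smul_eq_mul,
    mul_comm] at this

theorem IsOptimalAnticode.rank_add_maxrk_le (hm : 1 ≤ m) (hkm : k ≤ m) {A : Code F k m}
    (hA : IsOptimalAnticode A) {N : Matrix (Fin k) (Fin m) F} (hN : N ∈ dual A) :
    N.rank + maxrk A ≤ k := by
  have : Fintype F := Fintype.ofFinite F
  by_contra! hlt
  obtain ⟨L, _, _, _, hL⟩ := exists_extension_finrank_eq F hm
  obtain ⟨h, hh⟩ := exists_linearIndependent_fin (F := F) (V := L) (hkm.trans hL.ge)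
  obtain ⟨b, Λ, hΛ⟩ := exists_traceProduct_eq_syndrome hL hh (μ := maxrk A) (N := N) (by omega)
  have hinj : Function.Injective ((syndrome (m := m) h b (maxrk A)).domRestrict A) := by
    rw [injective_iff_map_eq_zero]
    exact fun M hM => Subtype.ext
      (eq_zero_of_syndrome_eq_zero hh b.linearIndependent (rank_le_maxrk M.2) hM)
  have hsurj := (LinearMap.injective_iff_surjective_of_finrank_eq_finrank (by
    rw [finrank_pi_fintype, Finset.sum_const, Finset.card_univ, Fintype.card_fin, hL, smul_eq_mul,
      mul_comm]
    exact hA)).mp hinj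
  -- Every matrix shares its syndrome with an element of `A`, where the functional of `N` vanishes.
  have hN0 : N = 0 := eq_zero_of_traceProduct_eq_zero fun M => by
    obtain ⟨M', hM'⟩ := hsurj (syndrome h b (maxrk A) M)
    rw [hΛ, ← hM', LinearMap.domRestrict_apply, ← hΛ]
    exact hN _ M'.2
  have := maxrk_le_height A
  rw [hN0, Matrix.rank_zero] at hlt
  omega

/-- The dual of an optimal anticode is an optimal anticode. -/
theorem IsOptimalAnticode.dual (hm : 1 ≤ m) (hkm : k ≤ m) {A : Code F k m}
    (hA : IsOptimalAnticode A) :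
    IsOptimalAnticode (dual A) ∧ maxrk (Delsarte.dual A) + maxrk A = k := by
  have h1 := finrank_add_finrank_dual A
  have h2 := finrank_le_mul_maxrk hm hkm (Delsarte.dual A)
  have h3 : maxrk (Delsarte.dual A) + maxrk A ≤ k := by
    have hk := maxrk_le_height A
    have : maxrk (Delsarte.dual A) ≤ k - maxrk A := maxrk_le fun N hN => by
      have := hA.rank_add_maxrk_le hm hkm hN
      omega
    omega
  unfold IsOptimalAnticode at hA ⊢
  -- The dual has dimension m (k - maxrk A), so the anticode bound forces the reverse inequality.
  have h4 : k ≤ maxrk (Delsarte.dual A) + maxrk A := by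
    refine le_of_mul_le_mul_left (a := m) ?_ hm
    rw [mul_add, mul_comm m k]
    omega
  refine ⟨?_, le_antisymm h3 h4⟩
  have h5 : m * (maxrk (Delsarte.dual A) + maxrk A) = k * m := by
    rw [le_antisymm h3 h4, mul_comm]
  rw [mul_add] at h5
  omega

theorem isOptimalAnticode_top (hm : 1 ≤ m) (hkm : k ≤ m) :
    IsOptimalAnticode (⊤ : Code F k m) := by
  refine le_antisymm (finrank_le_mul_maxrk hm hkm _) ?_
  rw [finrank_top, Module.finrank_matrix, finrank_self, Fintype.card_fin, Fintype.card_fin,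
    mul_one, mul_comm k]
  exact Nat.mul_le_mul_left _ (maxrk_le_height _)

/-- A generalized weight is the least maximum rank of an optimal anticode meeting the code in large
enough dimension. -/
theorem exists_genWeight_eq_maxrk (hm : 1 ≤ m) (hkm : k ≤ m) {C : Code F k m} {r : ℤ}
    (hr : r ≤ finrank F C) :
    ∃ A : Code F k m, IsOptimalAnticode A ∧ r ≤ finrank F (A ⊓ C : Code F k m) ∧
      genWeight C r = maxrk A ∧
      ∀ A' : Code F k m, IsOptimalAnticode A' → r ≤ finrank F (A' ⊓ C : Code F k m) →
        maxrk A ≤ maxrk A' := by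
  let S : Set ℕ := {d : ℕ | ∃ A : Code F k m, IsOptimalAnticode A ∧
      r ≤ (finrank F (A ⊓ C : Code F k m) : ℤ) ∧ finrank F A = d}
  have hS : S.Nonempty := ⟨_, ⊤, isOptimalAnticode_top hm hkm, by rwa [top_inf_eq], rfl⟩
  obtain ⟨A, hA, hrA, hd⟩ := Nat.sInf_mem hS
  have hm0 : (m : ℚ) ≠ 0 := by exact_mod_cast (by omega : m ≠ 0)
  refine ⟨A, hA, hrA, ?_, fun A' hA' hr' => ?_⟩
  · change 1 / (m : ℚ) * ((sInf S : ℕ) : ℚ) = _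
    rw [← hd, hA]
    push_cast
    field_simp
  · have : sInf S ≤ finrank F A' := Nat.sInf_le ⟨A', hA', hr', rfl⟩
    rw [← hd, hA, hA'] at this
    exact le_of_mul_le_mul_left this hm

end Anticode

end Delsarte

theorem theorem7p5 {F : Type*} [Field F] [Finite F] (k m : ℕ) (hk : 1 ≤ k) (hkm : k ≤ m)
    (C : Delsarte.Code F k m) (t : ℕ) (hC : Module.finrank F C = t)
    (ht1 : 1 ≤ t) (ht2 : t ≤ k * m - 1) (p i j : ℤ)
    (h1 : 1 ≤ p + i * (m : ℤ)) (h2 : p + i * (m : ℤ) ≤ (k : ℤ) * (m : ℤ) - (t : ℤ))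
    (h3 : 1 ≤ p + (t : ℤ) + j * (m : ℤ)) (h4 : p + (t : ℤ) + j * (m : ℤ) ≤ (t : ℤ)) :
    Delsarte.genWeight (Delsarte.dual C) (p + i * (m : ℤ)) ≠
      (k : ℚ) + 1 - Delsarte.genWeight C (p + (t : ℤ) + j * (m : ℤ)) := by
  have hm : 1 ≤ m := hk.trans hkm
  have hdim := Delsarte.finrank_add_finrank_dual C
  obtain ⟨A, hA, hrA, haw, hAmin⟩ := Delsarte.exists_genWeight_eq_maxrk hm hkm
    (h4.trans_eq (congrArg Nat.cast hC.symm))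
  obtain ⟨B, hB, hrB, hbw, hBmin⟩ := Delsarte.exists_genWeight_eq_maxrk hm hkm
    (C := Delsarte.dual C) (r := p + i * (m : ℤ)) (by
      rw [hC] at hdim
      zify at hdim
      linarith)
  rw [haw, hbw]
  intro heq
  have hab : Delsarte.maxrk B + Delsarte.maxrk A = k + 1 := by
    have : (Delsarte.maxrk B : ℚ) + Delsarte.maxrk A = k + 1 := by linarith
    exact_mod_cast this
  obtain ⟨hA', hAk⟩ := hA.dual hm hkm
  obtain ⟨hB', hBk⟩ := hB.dual hm hkm
  -- `dual A` has maximum rank b - 1, so minimality of `B` excludes it as a competitor.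
  have hltA := lt_of_not_ge fun h => absurd (hBmin _ hA' h) (by omega)
  have hltB := lt_of_not_ge fun h => absurd (hAmin _ hB' h) (by omega)
  have hdA := Delsarte.finrank_dual_inf_dual A C
  have hdB := Delsarte.finrank_dual_inf_dual B (Delsarte.dual C)
  rw [Delsarte.dual_dual] at hdB
  unfold Delsarte.IsOptimalAnticode at hA hB
  rw [hA, hC] at hdA
  rw [hB] at hdB
  rw [hC] at hdim
  zify at hab hdim hdA hdB
  have hm' : (0 : ℤ) < m := by exact_mod_cast hm
  -- The dimension formula bounds dim (`dual A ⊓ dual C`) below by m (k - a + j) + p, while `hltA`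
  -- bounds it above by p + im; `p` cancels.
  have hi : (k : ℤ) - Delsarte.maxrk A + j < i := by
    refine lt_of_mul_lt_mul_left (a := (m : ℤ)) ?_ hm'.le
    linarith
  have hj : i < Delsarte.maxrk B + j := by
    refine lt_of_mul_lt_mul_left (a := (m : ℤ)) ?_ hm'.le
    linarith
  linarith
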